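/- Let $k$ be a number field, $n_k=[k:\mathbb Q]$, let $S$ be a finite set of places of $k$ containing all Archimedean places, $\mathcal O_{k,S}$ the ring of $S$-integers, $H$ the absolute multiplicative Weil height, and let $f,g\in k[x]$ be nonconstant. Put $$N^{\mathrm{new}}_{f,g,k,S}(B)=\#\{a\in\mathcal O_{k,S}:\ H(a)\le B,\ \exists\,y\in k \text{ with } g(y)=f(a)\text{ and } y\ne h(a)\text{ for every } h\in k[x]\text{ with } f=g\circ h\}.$$ Let $C$ be an irreducible component of the reduced plane curve $f(X)-g(Y)=0$ over $k$, with affine normalization $C^\nu$ and smooth projective normalization $\widetilde C$. Assume that * $C$ is not a graph $Y=h(X)$ with $h\in k[x]$, $f=g\circ h$; * $C$ is geometrically integral, $\widetilde C\cong\mathbb P^1_k$, and $\widetilde C\setminus C^\nu$ has exactly one geometric point (so $C^\nu\cong\mathbb A^1_k$, and for a coordinate $t$ on $C^\nu$ one has $X=A(t)$ with $A\in k[t]$); * $C$ is $S$-active: the function $X$ takes a value in $\mathcal O_{k,S}$ at some $k$-rational point of $C^\nu$ (that is, $A(k)\cap\mathcal O_{k,S}\neq\varnothing$). Let $d=d_X(C)=[k(C):k(X)]$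 $(=\deg A)$. Then there are $c>0$ and $B_0$, depending only on $k,S,f,g,C$, such that $$N^{\mathrm{new}}_{f,g,k,S}(B)\ \ge\ c\,B^{n_k/d}\,(\log 2B)^{|S|-1}\qquad\text{for all } B\ge B_0 .$$ In particular the power-log order attached to $C$ cannot be lowered in an upper bound: if $\alpha,\beta\in\mathbb R$ and $N^{\mathrm{new}}_{f,g,k,S}(B)=O\big(B^{\alpha}(\log 2B)^{\beta}\big)$ as $B\to\infty$, then $\alpha>n_k/d$, or $\alpha=n_k/d$ and $\beta\ge|S|-1$. -/

import Mathlib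

open Polynomial NumberField IsDedekindDomain Filter Asymptotics
open scoped TensorProduct

noncomputable section

namespace SparseLifting

/-! ### Places, `S`-integers, heights and the counting function -/

section Arithmetic

variable (k : Type*) [Field k] [NumberField k]

/-- A place of a number field: an Archimedean place or a (nonzero) prime of the ring of integers. -/
abbrev NFPlace : Type _ := InfinitePlace k ⊕ HeightOneSpectrum (𝓞 k)

variable {k}

/-- The set of `S`-integers `𝒪_{k,S}`: the elements which are `v`-integral
at every finite place `v` outside `S`. -/
def sIntegers (S : Finset (NFPlace k)) : Set k :=
  {a | ∀ v : HeightOneSpectrum (𝓞 k), Sum.inr v ∉ S → v.valuation k a ≤ 1}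

/-- The absolute multiplicative Weil height of an element of `k`. Mathlib's `Height.mulHeight₁` is
the height relative to `k`, i.e. `∏_v max(1, |a|_v)` with the normalized absolute values of `k`. -/
def absHeight (a : k) : ℝ :=
  Height.mulHeight₁ a ^ ((1 : ℝ) / (Module.finrank ℚ k : ℝ))

/-- The `S`-integral inputs `a` of height at most `B` which admit a new rational lift: some `y ∈ k`
with `g(y) = f(a)` that differs from `h(a)` for every `h ∈ k[x]` with `f = g ∘ h`. -/
def newInputs (f g : k[X]) (S : Finset (NFPlace k)) (B : ℝ) : Set k :=
  {a | a ∈ sIntegers S ∧ absHeight a ≤ B ∧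
    ∃ y : k, g.eval y = f.eval a ∧ ∀ h : k[X], f = g.comp h → y ≠ h.eval a}

/-- The counting function `N^new_{f,g,k,S}(B)`. -/
def newCount (f g : k[X]) (S : Finset (NFPlace k)) (B : ℝ) : ℕ :=
  (newInputs f g S B).ncard

end Arithmetic

/-! ### Components of the curve `f(X) = g(Y)` -/

section Curve

variable {k : Type*} [Field k]

/-- The polynomial `f(X) - g(Y)` in the two variables `X = X₀`, `Y = X₁`. -/
def curvePoly (f g : k[X]) : MvPolynomial (Fin 2) k :=
  aeval (MvPolynomial.X 0) f - aeval (MvPolynomial.X 1) g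

/-- An irreducible component of the reduced plane curve `C_{f,g} : f(X) - g(Y) = 0`, given by its
prime ideal, which is a minimal prime over `f(X) - g(Y)`. -/
structure Component (f g : k[X]) where
  /-- The prime ideal of the component in `k[X, Y]`. -/
  ideal : Ideal (MvPolynomial (Fin 2) k)
  mem_minimalPrimes : ideal ∈ (Ideal.span {curvePoly f g}).minimalPrimes

namespace Component

variable {f g : k[X]} (C : Component f g)

instance isPrime_ideal : C.ideal.IsPrime := C.mem_minimalPrimes.1.1

/-- `C` is a graph component: `C` is the curve `Y = h(X)` for some `h ∈ k[x]` with `f = g ∘ h`. -/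
def IsGraph : Prop :=
  ∃ h : k[X], f = g.comp h ∧
    C.ideal = Ideal.span {MvPolynomial.X 1 - aeval (MvPolynomial.X 0 : MvPolynomial (Fin 2) k) h}

/-- The affine coordinate ring `k[C]`. -/
abbrev CoordRing : Type _ := MvPolynomial (Fin 2) k ⧸ C.ideal

/-- The function field `k(C)`. -/
abbrev FunctionField : Type _ := FractionRing C.CoordRing

/-- The coordinate ring of the affine normalization `C^ν`: the integral closure of `k[C]`
in `k(C)`. -/
abbrev Normalization : Subalgebra C.CoordRing C.FunctionField :=
  integralClosure C.CoordRing C.FunctionField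

/-- The coordinate function `X` in `k[C]`. -/
def coordX : C.CoordRing := Ideal.Quotient.mk C.ideal (MvPolynomial.X 0)

/-- The projection degree `d_X(C) = [k(C) : k(X)]`. -/
def degX : ℕ :=
  Module.finrank
    (IntermediateField.adjoin k {algebraMap C.CoordRing C.FunctionField C.coordX})
    C.FunctionField

/-- `C` is geometrically integral. -/
def IsGeomIntegral : Prop := IsDomain (AlgebraicClosure k ⊗[k] C.CoordRing)

/-- The smooth projective normalization of `C` is isomorphic to the projective line over `k`. A
smooth projective curve is determined up to isomorphism over `k` by its function field, and
`k(ℙ¹) = k(t)`. -/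
def IsRational : Prop := Nonempty (C.FunctionField ≃ₐ[k] RatFunc k)

/-- A geometric point of the boundary `D_C`, the complement of the affine normalization `C^ν` in
the smooth projective normalization `C̃`.

The closed points of `C̃` are the nontrivial valuation rings of `k(C)` which contain `k`; such a
point lies on `C^ν` exactly when its valuation ring contains the coordinate ring of `C^ν`.
A geometric point is a closed point together with a `k`-embedding of its residue field into the
algebraic closure of `k`. -/
structure GeomBoundaryPoint where
  /-- The valuation ring of the underlying closed point of `C̃`. -/
  place : ValuationSubring C.FunctionField
  const_mem : ∀ c : k, algebraMap k C.FunctionField c ∈ place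
  atInfinity : ∃ r ∈ C.Normalization, r ∉ place
  /-- The embedding of the residue field. -/
  emb : IsLocalRing.ResidueField place →+* AlgebraicClosure k
  emb_const : ∀ c : k,
    emb (IsLocalRing.residue place ⟨algebraMap k C.FunctionField c, const_mem c⟩) =
      algebraMap k (AlgebraicClosure k) c

/-- `C` is a non-graph rational component with exactly one geometric point at infinity, i.e. `C`
belongs to `R₁(f, g; k)`. -/
structure IsOneInfinity : Prop where
  not_isGraph : ¬ C.IsGraph
  isGeomIntegral : C.IsGeomIntegral
  isRational : C.IsRational
  card_boundary : Nat.card C.GeomBoundaryPoint = 1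

end Component

end Curve

section Active

variable {k : Type*} [Field k] [NumberField k] {f g : k[X]}

/-- `C` is `S`-active: the coordinate `X` takes an `S`-integral value at some `k`-rational point of
the affine normalization `C^ν`. When `C^ν` is an affine line with coordinate `t` and `X = A(t)`,
the set of these values is `A(k)`; see `Component.isSActive_iff`. -/
def Component.IsSActive (C : Component f g) (S : Finset (NFPlace k)) : Prop :=
  ∃ P : C.Normalization →ₐ[k] k,
    P (algebraMap C.CoordRing C.Normalization C.coordX) ∈ sIntegers S

/-- For any coordinate `t` on the affine normalization, i.e. any isomorphism `e` of its coordinate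
ring with `k[t]`, being `S`-active means that `A(k)` meets the `S`-integers, where `X = A(t)`. -/
theorem Component.isSActive_iff (C : Component f g) (S : Finset (NFPlace k))
    (e : C.Normalization ≃ₐ[k] k[X]) (A : k[X])
    (hA : e (algebraMap C.CoordRing C.Normalization C.coordX) = A) :
    C.IsSActive S ↔ (Set.range (fun τ : k => A.eval τ) ∩ sIntegers S).Nonempty := by
  subst hA
  constructor
  · rintro ⟨P, hP⟩
    refine ⟨_, ⟨P (e.symm X), rfl⟩, ?_⟩
    have h : (P.comp e.symm.toAlgHom) = aeval (P (e.symm X)) := by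
      ext; simp
    have h2 := DFunLike.congr_fun h (e (algebraMap C.CoordRing C.Normalization C.coordX))
    simp only [AlgHom.comp_apply, coe_aeval_eq_eval] at h2
    simpa [← h2] using hP
  · rintro ⟨_, ⟨τ, rfl⟩, hτ⟩
    exact ⟨(aeval τ).comp e.toAlgHom, by simpa [coe_aeval_eq_eval] using hτ⟩

end Active

end SparseLifting

end

/-! On the affine normalization, with coordinate t, X = A(t). Since g(Y) = f(X), the function Y is
integral over k[t], so Y = D(t) and f ∘ A = g ∘ D. Every τ in k with A(τ) an S-integer thus gives an
input A(τ) with lift D(τ). The lift is new unless D(τ) = h(A(τ)) for one of the finitely many h with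
f = g ∘ h. As C is not a graph, D ≠ h ∘ A, so only finitely many τ are lost; moreover A is at most
d-to-one (`exists_many_newInputs`).

Many τ come from one active τ₀ by setting τ = τ₀ + b·w/η, where b clears the denominators of the
Taylor coefficients of A at τ₀ and η is a unit outside S (`exists_many_integral_values`). If w and η
have Archimedean size O(M), then A(τ) has absolute height O(M^d). There are at least M^n numerators
w, and a constant times (log M)^(|S|-1) denominators η, the exponent being the unit rank plus the
number of finite places in S. Each quotient repeats boundedly often (`exists_many_quotients`).
Taking B of order M^d gives the bound.

The coordinate is found in `exists_polynomial_coordinate`: in any parametrization by k(t), distinct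
finite poles of X are distinct geometric boundary points, so there is at most one; it is k-rational
and can be moved to infinity. -/

namespace SparseLifting

/-! ### Counting quotients w/η with denominators supported on finitely many primes -/

section Counting

variable {k : Type*} [Field k] [NumberField k]

/-- The height of x/y is that of the point (x : y). For integral coordinates the finite part is the
inverse of the norm of the ideal (x, y), hence at most 1. -/
theorem mulHeight₁_div_le {x y : 𝓞 k} (hy : y ≠ 0) {H : ℝ}
    (hx : ∀ v : InfinitePlace k, v (x : k) ≤ H) (hyH : ∀ v : InfinitePlace k, v (y : k) ≤ H) :
    Height.mulHeight₁ ((x : k) / y) ≤ H ^ Module.finrank ℚ k := by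
  have hne : (![x, y] : Fin 2 → 𝓞 k) ≠ 0 := fun h => hy (by simpa using congrFun h 1)
  have hnek : (fun i => ((![x, y] : Fin 2 → 𝓞 k) i : k)) ≠ 0 := fun h => hne <| by
    ext i; simpa using congrFun h i
  have hfin : (∏ᶠ v : FinitePlace k, ⨆ i, v ((![x, y] : Fin 2 → 𝓞 k) i : k)) ≤ 1 := by
    have h1 := absNorm_mul_finprod_finitePlace_eq_one hne
    have h2 : (1 : ℝ) ≤ (Ideal.span (Set.range ![x, y])).absNorm := by
      have : (Ideal.span (Set.range ![x, y])).absNorm ≠ 0 := fun h0 => by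
        rw [h0] at h1
        simp at h1
      exact_mod_cast Nat.one_le_iff_ne_zero.mpr this
    have h3 : 0 ≤ ∏ᶠ v : FinitePlace k, ⨆ i, v ((![x, y] : Fin 2 → 𝓞 k) i : k) :=
      finprod_nonneg fun _ => Real.iSup_nonneg_of_nonnegHomClass ..
    nlinarith
  have hvec : ![(x : k), (y : k)] = fun i => ((![x, y] : Fin 2 → 𝓞 k) i : k) := by
    ext i; fin_cases i <;> rfl
  rw [Height.mulHeight₁_div_eq_mulHeight, hvec, mulHeight_eq hnek,
    ← InfinitePlace.sum_mult_eq, ← Finset.prod_pow_eq_pow_sum]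
  refine (mul_le_of_le_one_right (Finset.prod_nonneg fun v _ => pow_nonneg
    (Real.iSup_nonneg_of_nonnegHomClass ..) _) hfin).trans ?_
  refine Finset.prod_le_prod (fun v _ => pow_nonneg
    (Real.iSup_nonneg_of_nonnegHomClass ..) _) fun v _ => ?_
  refine pow_le_pow_left₀ (Real.iSup_nonneg_of_nonnegHomClass ..) (ciSup_le fun i => ?_) _
  fin_cases i
  · exact hx v
  · exact hyH v

/-- With h the class number, p^h is principal, and π is a generator. -/
theorem exists_prime_power_generator (p : HeightOneSpectrum (𝓞 k)) :
    ∃ π : 𝓞 k, π ≠ 0 ∧ p.valuation k (π : k) < 1 ∧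
      ∀ q : HeightOneSpectrum (𝓞 k), q ≠ p → q.valuation k (π : k) = 1 := by
  have hmem : p.asIdeal ∈ nonZeroDivisors (Ideal (𝓞 k)) := mem_nonZeroDivisors_of_ne_zero p.ne_bot
  set h := Fintype.card (ClassGroup (𝓞 k))
  have hpos : h ≠ 0 := Fintype.card_ne_zero
  have hone : ClassGroup.mk0 (⟨p.asIdeal ^ h, pow_mem hmem h⟩ : nonZeroDivisors (Ideal (𝓞 k))) = 1 := by
    have : (⟨p.asIdeal ^ h, pow_mem hmem h⟩ : nonZeroDivisors (Ideal (𝓞 k)))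
      = ⟨p.asIdeal, hmem⟩ ^ h := rfl
    rw [this, map_pow, pow_card_eq_one]
  rw [ClassGroup.mk0_eq_one_iff] at hone
  obtain ⟨π, hπ⟩ := hone.principal
  rw [Ideal.submodule_span_eq] at hπ
  have hπmem : π ∈ p.asIdeal ^ h := by rw [hπ]; exact Ideal.mem_span_singleton_self π
  refine ⟨π, ?_, ?_, fun q hq => ?_⟩
  · rintro rfl
    exact pow_ne_zero h p.ne_bot (by simpa using hπ)
  · exact (p.valuation_lt_one_iff_mem _).2 (Ideal.pow_le_self hpos hπmem)
  · refine q.valuation_eq_one_iff_notMem.2 fun hmem => hq ?_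
    have hle : p.asIdeal ^ h ≤ q.asIdeal := by
      rw [hπ]; exact (Ideal.span_singleton_le_iff_mem _).2 hmem
    have := q.isPrime.le_of_pow_le hle
    exact HeightOneSpectrum.ext (p.isMaximal.eq_of_le q.isPrime.ne_top this).symm

theorem valuation_unit_eq_one (p : HeightOneSpectrum (𝓞 k)) (u : (𝓞 k)ˣ) :
    p.valuation k (u : k) = 1 :=
  p.valuation_eq_one_iff_notMem.2 fun h => p.isPrime.ne_top (Ideal.eq_top_of_isUnit_mem _ h u.isUnit)

theorem infinitePlace_natCast {F : Type*} [Field F] (v : InfinitePlace F) (n : ℕ) : v (n : F) = n := by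
  rw [← v.norm_embedding_eq, map_natCast, Complex.norm_natCast]

variable (k) in
theorem prod_fundSystem_injective :
    Function.Injective fun e : Fin (Units.rank k) → ℕ => ∏ i, Units.fundSystem k i ^ e i := by
  intro e e' h
  obtain ⟨z, -, hz⟩ := Units.exist_unique_eq_mul_prod k (∏ i, Units.fundSystem k i ^ e i)
  have h1 := hz (1, fun i => (e i : ℤ)) (by simp)
  have h2 := hz (1, fun i => (e' i : ℤ)) (by simpa using h)
  have := (Prod.ext_iff.1 (h1.trans h2.symm)).2
  ext i
  have hi := congrFun this i
  simpa using hi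

/-- Multiplicatively independent algebraic integers which are units outside `P`. -/
theorem exists_independent_family (P : Finset (HeightOneSpectrum (𝓞 k))) :
    ∃ ρ : Fin (Units.rank k) ⊕ P → 𝓞 k, (∀ i, ρ i ≠ 0) ∧
      (∀ i, ∀ q ∉ P, q.valuation k (ρ i : k) = 1) ∧
      Function.Injective fun e : Fin (Units.rank k) ⊕ P → ℕ => ∏ i, ρ i ^ e i := by
  choose π h0 hlt h1 using fun p : P => exists_prime_power_generator p.1
  refine ⟨Sum.elim (fun i => (Units.fundSystem k i : 𝓞 k)) π, ?_, ?_, ?_⟩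
  · rintro (i | p)
    · exact (Units.fundSystem k i).ne_zero
    · exact h0 p
  · rintro (i | p) q hq
    · exact valuation_unit_eq_one q _
    · exact h1 p q (fun h => hq (h ▸ p.2))
  · intro e e' h
    simp only [Fintype.prod_sum_type, Sum.elim_inl, Sum.elim_inr] at h
    -- Units and the other π q are units at p, so the valuation at p isolates the exponent of π p.
    have hval (e : Fin (Units.rank k) ⊕ P → ℕ) (p : P) :
        p.1.valuation k ((((∏ i, (Units.fundSystem k i : 𝓞 k) ^ e (Sum.inl i)) *
          ∏ q, π q ^ e (Sum.inr q) : 𝓞 k)) : k) =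
          p.1.valuation k (π p : k) ^ e (Sum.inr p) := by
      simp only [map_mul, map_prod, map_pow]
      rw [Finset.prod_eq_one (fun i _ => by rw [valuation_unit_eq_one, one_pow]), one_mul]
      refine Finset.prod_eq_single p (fun q _ hq => ?_) (by simp)
      rw [h1 q p.1 (fun h => hq (Subtype.ext h.symm)), one_pow]
    have hr : ∀ p, e (Sum.inr p) = e' (Sum.inr p) := fun p => by
      have := hval e p
      rw [h, hval e' p] at this
      exact (pow_right_injective₀ (zero_lt_iff.2 <| by simpa using h0 p) (hlt p).ne this).symm
    have hne : ∏ q, π q ^ e (Sum.inr q) ≠ 0 := Finset.prod_ne_zero_iff.2 fun q _ =>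
      pow_ne_zero _ (h0 q)
    have hl : (fun i => e (Sum.inl i)) = fun i => e' (Sum.inl i) := by
      refine prod_fundSystem_injective k (Units.ext ?_)
      simp only [← hr] at h
      simpa using mul_right_cancel₀ hne h
    ext (i | p)
    · exact congrFun hl i
    · exact hr p

/-- The denominators are the products of an independent family with all exponents at most L, where L
is of order log M; independence makes them pairwise distinct. -/
theorem exists_many_denominators (P : Finset (HeightOneSpectrum (𝓞 k))) :
    ∃ c : ℝ, 0 < c ∧ ∀ M : ℕ, 1 ≤ M → ∃ E : Finset (𝓞 k),
      c * Real.log M ^ (Units.rank k + P.card) ≤ E.card ∧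
      ∀ η ∈ E, η ≠ 0 ∧ (∀ v : InfinitePlace k, v (η : k) ≤ M) ∧
        ∀ q ∉ P, q.valuation k (η : k) = 1 := by
  classical
  let ι := Fin (Units.rank k) ⊕ P
  obtain ⟨ρ, h0, hval, hinj⟩ : ∃ ρ : ι → 𝓞 k, (∀ i, ρ i ≠ 0) ∧
      (∀ i, ∀ q ∉ P, q.valuation k (ρ i : k) = 1) ∧
      Function.Injective fun e : ι → ℕ => ∏ i, ρ i ^ e i := exists_independent_family P
  have hcard : Fintype.card ι = Units.rank k + P.card := by simp [ι]
  obtain ⟨R, hR⟩ := Finite.bddAbove_range fun z : ι × InfinitePlace k => z.2 (ρ z.1 : k)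
  have hR' : ∀ i (v : InfinitePlace k), v (ρ i : k) ≤ max R 2 := fun i v =>
    (hR ⟨(i, v), rfl⟩).trans (le_max_left _ _)
  set R' := max R 2
  have hR2 : 2 ≤ R' := le_max_right _ _
  have hlogR : 0 < Real.log R' := Real.log_pos (by linarith)
  -- Chosen so that R'^(L·|ι|) ≤ M once L·D ≤ log M; the +1 keeps D positive when ι is empty.
  set D : ℝ := (Fintype.card ι + 1) * Real.log R'
  have hD : 0 < D := by positivity
  refine ⟨D⁻¹ ^ Fintype.card ι, by positivity, fun M hM => ?_⟩
  have hM' : (1 : ℝ) ≤ M := by exact_mod_cast hM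
  set L := ⌊Real.log M / D⌋₊
  have hlogM : 0 ≤ Real.log M := Real.log_nonneg hM'
  have hL : L * D ≤ Real.log M := by
    rw [← le_div_iff₀ hD]; exact Nat.floor_le (by positivity)
  refine ⟨(Fintype.piFinset fun _ : ι => Finset.range (L + 1)).image fun e => ∏ i, ρ i ^ e i, ?_, ?_⟩
  · rw [Finset.card_image_of_injective _ hinj, Fintype.card_piFinset, Finset.prod_const,
      Finset.card_univ, ← hcard, Finset.card_range, ← mul_pow]
    push_cast
    refine pow_le_pow_left₀ (by positivity) ?_ _
    rw [inv_mul_eq_div]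
    exact (Nat.lt_floor_add_one _).le
  · simp only [Finset.mem_image, Fintype.mem_piFinset, Finset.mem_range]
    rintro _ ⟨e, he, rfl⟩
    refine ⟨Finset.prod_ne_zero_iff.2 fun i _ => pow_ne_zero _ (h0 i), fun v => ?_, fun q hq => ?_⟩
    · simp only [map_prod, map_pow]
      calc ∏ i, v (ρ i : k) ^ e i ≤ ∏ _i : ι, R' ^ L := by
            refine Finset.prod_le_prod (fun i _ => by positivity) fun i _ => ?_
            exact (pow_le_pow_left₀ (apply_nonneg _ _) (hR' i v) _).trans
              (pow_le_pow_right₀ (by linarith) (Nat.lt_succ_iff.1 (he i)))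
        _ = R' ^ (L * Fintype.card ι) := by simp [pow_mul]
        _ ≤ M := by
            rw [← Real.log_le_log_iff (by positivity) (by positivity), Real.log_pow]
            refine le_trans ?_ hL
            push_cast
            rw [mul_assoc]
            gcongr
            linarith
    · simp only [map_prod, map_pow]
      exact Finset.prod_eq_one fun i _ => by rw [hval i q hq, one_pow]

/-- The numerators are 1 + Q(CM + ∑ aᵢbᵢ) with 0 ≤ aᵢ ≤ M and (bᵢ) an integral basis. Being 1 modulo
Q they avoid the primes of P, and the dominant term CM fixes their size at all Archimedean places
simultaneously. -/
theorem exists_many_numerators (P : Finset (HeightOneSpectrum (𝓞 k))) :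
    ∃ K : ℝ, 1 ≤ K ∧ ∀ M : ℕ, 1 ≤ M → ∃ W : Finset (𝓞 k),
      M ^ Module.finrank ℚ k ≤ W.card ∧
      ∀ w ∈ W, (∀ v : InfinitePlace k, (M : ℝ) ≤ v (w : k) ∧ v (w : k) ≤ K * M) ∧
        ∀ q ∈ P, q.valuation k (w : k) = 1 := by
  classical
  set b := RingOfIntegers.basis k
  set ι := Module.Free.ChooseBasisIndex ℤ (𝓞 k)
  have hcard : Fintype.card ι = Module.finrank ℚ k := by
    rw [← RingOfIntegers.rank, Module.finrank_eq_card_chooseBasisIndex]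
  set Q : ℕ := ∏ p ∈ P, p.asIdeal.absNorm
  have hQ0 : 1 ≤ Q := Nat.one_le_iff_ne_zero.2 <| Finset.prod_ne_zero_iff.2 fun p _ =>
    fun h => p.ne_bot (Ideal.absNorm_eq_zero_iff.1 h)
  have hQmem : ∀ p ∈ P, (Q : 𝓞 k) ∈ p.asIdeal := fun p hp =>
    Ideal.mem_of_dvd _ (Nat.cast_dvd_cast (Finset.dvd_prod_of_mem _ hp)) (Ideal.absNorm_mem _)
  obtain ⟨R, hR⟩ := Finite.bddAbove_range fun v : InfinitePlace k => ∑ i, v (b i : k)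
  -- Large enough that the sum over the basis is at most half of CM at each Archimedean place.
  set C : ℕ := 2 * ⌈R⌉₊ + 2
  have hC : ∀ v : InfinitePlace k, 2 * ∑ i, v (b i : k) ≤ C := fun v => by
    have := (hR ⟨v, rfl⟩).trans (Nat.le_ceil R)
    simp only [C]; push_cast; linarith
  have hC2 : (2 : ℝ) ≤ C := by simp [C]
  have hQ1 : (1 : ℝ) ≤ Q := by exact_mod_cast hQ0
  set w : ℕ → (ι → ℕ) → 𝓞 k := fun M a => 1 + Q * (C * M + ∑ i, a i • b i)
  have hwinj (M : ℕ) : Function.Injective (w M) := by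
    intro a a' h
    have h1 : ∑ i, a i • b i = ∑ i, a' i • b i := by
      have h2 := mul_left_cancel₀ (by exact_mod_cast (by omega : Q ≠ 0)) (add_left_cancel h)
      exact add_left_cancel h2
    have h3 := congrArg b.equivFun h1
    ext i
    have := congrFun h3 i
    simpa [← nsmul_eq_mul, -nsmul_eq_mul, Finsupp.single_apply] using this
  refine ⟨3 * Q * C, by nlinarith, fun M hM => ?_⟩
  have hM1 : (1 : ℝ) ≤ M := by exact_mod_cast hM
  refine ⟨(Fintype.piFinset fun _ : ι => Finset.range (M + 1)).image (w M), ?_, ?_⟩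
  · rw [Finset.card_image_of_injective _ (hwinj M), Fintype.card_piFinset, Finset.prod_const,
      Finset.card_univ, hcard, Finset.card_range]
    exact Nat.pow_le_pow_left (by omega) _
  · simp only [Finset.mem_image, Fintype.mem_piFinset, Finset.mem_range]
    rintro _ ⟨a, ha, rfl⟩
    refine ⟨fun v => ?_, fun q hq => ?_⟩
    · set s : k := Q * ∑ i, (a i : k) * (b i : k)
      have hs : 2 * v s ≤ Q * (C * M) := by
        have h1 : v (∑ i, (a i : k) * (b i : k)) ≤ ∑ i, M * v (b i : k) := by
          refine (AbsoluteValue.sum_le v.1 _ _).trans (Finset.sum_le_sum fun i _ => ?_)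
          rw [map_mul]
          have h2 : v.1 (a i : k) = a i := infinitePlace_natCast v (a i)
          rw [h2]
          have : (a i : ℝ) ≤ M := by exact_mod_cast Nat.lt_succ_iff.1 (ha i)
          exact mul_le_mul_of_nonneg_right this (apply_nonneg _ _)
        have h3 : v s = Q * v (∑ i, (a i : k) * (b i : k)) := by
          simp only [s, map_mul]
          rw [infinitePlace_natCast]
        rw [h3, mul_left_comm]
        refine mul_le_mul_of_nonneg_left ?_ (by positivity)
        rw [← Finset.mul_sum] at h1
        nlinarith [hC v]
      have hw : ((w M a : 𝓞 k) : k) = ((1 + Q * (C * M) : ℕ) : k) + s := by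
        simp only [w, s]
        push_cast
        simp only [nsmul_eq_mul]
        ring
      have hv1 : v ((1 + Q * (C * M) : ℕ) : k) = 1 + Q * (C * M) := by
        rw [infinitePlace_natCast]; push_cast; ring
      have hup := v.1.add_le ((1 + Q * (C * M) : ℕ) : k) s
      have hlo := v.1.le_sub ((1 + Q * (C * M) : ℕ) : k) (-s)
      rw [sub_neg_eq_add, v.1.map_neg] at hlo
      have e1 : v.1 ((1 + Q * (C * M) : ℕ) : k) = 1 + Q * (C * M) := hv1
      have e2 : v.1 s = v s := rfl
      have e3 : v.1 (((1 + Q * (C * M) : ℕ) : k) + s) = v (w M a : k) := by rw [hw]; rfl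
      rw [e1, e2, e3] at hup hlo
      have hCM : 2 * (M : ℝ) ≤ C * M := by nlinarith
      have hQCM : C * (M : ℝ) ≤ Q * (C * M) := by nlinarith
      constructor
      · linarith
      · linarith
    · refine q.valuation_eq_one_iff_notMem.2 fun hmem => q.isPrime.ne_top ?_
      rw [Ideal.eq_top_iff_one]
      exact (Ideal.add_mem_iff_left _ (Ideal.mul_mem_right _ _ (hQmem q hq))).1 hmem

/-- If w'/η' = w/η, then w'/w = η'/η is a unit at P by the first form and outside P by the second.
It is an algebraic integer whose conjugates are at most K, so it lies in a finite set independent of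
M, and the fibres of (w, η) ↦ w/η are uniformly bounded. -/
theorem exists_many_quotients (P : Finset (HeightOneSpectrum (𝓞 k))) :
    ∃ c : ℝ, 0 < c ∧ ∃ K : ℝ, 1 ≤ K ∧ ∀ M : ℕ, 1 ≤ M → ∃ T : Finset k,
      c * ((M : ℝ) ^ Module.finrank ℚ k * Real.log M ^ (Units.rank k + P.card)) ≤ T.card ∧
      ∀ u ∈ T, ∃ w η : 𝓞 k, η ≠ 0 ∧ u = w / η ∧ (∀ v : InfinitePlace k, v (w : k) ≤ K * M) ∧
        (∀ v : InfinitePlace k, v (η : k) ≤ K * M) ∧ ∀ q ∉ P, q.valuation k (η : k) = 1 := by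
  classical
  obtain ⟨c, hc, hE⟩ := exists_many_denominators P
  obtain ⟨K, hK, hW⟩ := exists_many_numerators P
  have hF := Embeddings.finite_of_norm_le k ℂ K
  set N := hF.toFinset.card
  refine ⟨c / (N + 1), by positivity, K, hK, fun M hM => ?_⟩
  obtain ⟨E, hEcard, hE⟩ := hE M hM
  obtain ⟨W, hWcard, hW⟩ := hW M hM
  have hM1 : (1 : ℝ) ≤ M := by exact_mod_cast hM
  have hlogM : 0 ≤ Real.log M := Real.log_nonneg hM1
  have hw0 : ∀ w ∈ W, (w : k) ≠ 0 := fun w hw h => by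
    obtain ⟨v⟩ : Nonempty (InfinitePlace k) := inferInstance
    have := ((hW w hw).1 v).1
    rw [h, map_zero] at this
    linarith
  set q : 𝓞 k × 𝓞 k → k := fun z => (z.1 : k) / z.2
  refine ⟨(W ×ˢ E).image q, ?_, ?_⟩
  · have hfib : ∀ u ∈ (W ×ˢ E).image q, ((W ×ˢ E).filter fun z => q z = u).card ≤ N := by
      intro u hu
      obtain ⟨⟨w, η⟩, hz, rfl⟩ := Finset.mem_image.1 hu
      rw [Finset.mem_product] at hz
      obtain ⟨hw, hη⟩ := hz
      have hη0 : (η : k) ≠ 0 := by simpa using (hE η hη).1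
      refine Finset.card_le_card_of_injOn (fun z => (z.1 : k) / w) ?_ ?_
      · rintro ⟨w', η'⟩ hz'
        simp only [Finset.coe_filter, Finset.mem_product, Set.mem_ofPred_eq] at hz'
        obtain ⟨⟨hw', hη'⟩, heq⟩ := hz'
        have hη0' : (η' : k) ≠ 0 := by simpa using (hE η' hη').1
        have hratio : (w' : k) / w = η' / η := by
          simp only [q] at heq
          rw [div_eq_div_iff hη0' hη0] at heq
          rw [div_eq_div_iff (hw0 w hw) hη0, heq, mul_comm]
        simp only [Set.Finite.coe_toFinset, Set.mem_ofPred_eq]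
        constructor
        · obtain ⟨r, hr⟩ := HeightOneSpectrum.mem_integers_of_valuation_le_one (R := 𝓞 k) k
            ((w' : k) / w) fun p => by
              by_cases hp : p ∈ P
              · rw [map_div₀, (hW w' hw').2 p hp, (hW w hw).2 p hp, div_one]
              · rw [hratio, map_div₀, (hE η' hη').2.2 p hp, (hE η hη).2.2 p hp, div_one]
          exact hr ▸ r.isIntegral_coe
        · intro φ
          have h1 := ((hW w' hw').1 (InfinitePlace.mk φ)).2
          have h2 := ((hW w hw).1 (InfinitePlace.mk φ)).1
          rw [InfinitePlace.apply] at h1 h2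
          rw [map_div₀, norm_div, div_le_iff₀ (by linarith)]
          nlinarith
      · rintro ⟨w₁, η₁⟩ h₁ ⟨w₂, η₂⟩ h₂ h
        simp only [Finset.coe_filter, Finset.mem_product, Set.mem_ofPred_eq] at h₁ h₂
        have hwe : w₁ = w₂ := RingOfIntegers.ext ((div_left_inj' (hw0 w hw)).1 h)
        subst hwe
        have := h₁.2.trans h₂.2.symm
        simp only [q] at this
        rw [div_eq_mul_inv, div_eq_mul_inv] at this
        rw [RingOfIntegers.ext (inv_injective (mul_left_cancel₀ (hw0 _ h₁.1.1) this))]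
    have h1 := Finset.card_le_mul_card_image _ _ hfib
    rw [Finset.card_product] at h1
    rw [div_mul_eq_mul_div, div_le_iff₀ (by positivity)]
    have h2 : (W.card * E.card : ℝ) ≤ N * ((W ×ˢ E).image q).card := by exact_mod_cast h1
    have h3 : ((M : ℝ) ^ Module.finrank ℚ k) ≤ W.card := by exact_mod_cast hWcard
    have h4 := mul_le_mul h3 hEcard (by positivity) (by positivity)
    nlinarith [Nat.cast_nonneg (α := ℝ) ((W ×ˢ E).image q).card]
  · intro u hu
    obtain ⟨⟨w, η⟩, hz, rfl⟩ := Finset.mem_image.1 hu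
    rw [Finset.mem_product] at hz
    exact ⟨w, η, (hE η hz.2).1, rfl, fun v => ((hW w hz.1).1 v).2,
      fun v => ((hE η hz.2).2.1 v).trans (by nlinarith), (hE η hz.2).2.2⟩

end Counting

end SparseLifting

namespace SparseLifting

/-! ### Integral values of a polynomial and new inputs -/

section Values

variable {k : Type*} [Field k] [NumberField k]

/-- A polynomial with one `P`-integral value takes many `P`-integral values of small height. -/
theorem exists_many_integral_values (P : Finset (HeightOneSpectrum (𝓞 k))) (A : k[X]) (τ₀ : k)
    (hτ₀ : ∀ q ∉ P, q.valuation k (A.eval τ₀) ≤ 1) :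
    ∃ c : ℝ, 0 < c ∧ ∃ K : ℝ, 1 ≤ K ∧ ∀ M : ℕ, 1 ≤ M → ∃ T : Finset k,
      c * ((M : ℝ) ^ Module.finrank ℚ k * Real.log M ^ (Units.rank k + P.card)) ≤ T.card ∧
      ∀ τ ∈ T, (∀ q ∉ P, q.valuation k (A.eval τ) ≤ 1) ∧
        Height.mulHeight₁ (A.eval τ) ≤ (K * (M : ℝ) ^ A.natDegree) ^ Module.finrank ℚ k := by
  classical
  obtain ⟨c, hc, K, hK, hT⟩ := exists_many_quotients P
  set d := A.natDegree
  set α : ℕ → k := fun i => (taylor τ₀ A).coeff i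
  -- A common denominator b of the Taylor coefficients of A at τ₀; substituting τ₀ + b·u absorbs it
  -- in every non-constant term.
  obtain ⟨⟨b, hb⟩, hβ⟩ := IsLocalization.exist_integer_multiples (nonZeroDivisors (𝓞 k))
    (Finset.range (d + 1)) α
  have hb0 : (b : k) ≠ 0 := by simpa using nonZeroDivisors.ne_zero hb
  have hβ' : ∀ i, ∃ β : 𝓞 k, i ∈ Finset.range (d + 1) → (β : k) = b * α i := fun i => by
    by_cases hi : i ∈ Finset.range (d + 1)
    · obtain ⟨β, hβ⟩ := hβ i hi
      exact ⟨β, fun _ => hβ.trans (Algebra.smul_def _ _)⟩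
    · exact ⟨0, fun h => absurd h hi⟩
  choose β hβ using hβ'
  obtain ⟨R, hR⟩ := Finite.bddAbove_range fun v : InfinitePlace k =>
    (∑ i ∈ Finset.range (d + 1), v ((β i : k) * (b : k) ^ i)) + v (b : k)
  set R' := max R 1
  have hR' : ∀ v : InfinitePlace k,
      (∑ i ∈ Finset.range (d + 1), v ((β i : k) * (b : k) ^ i)) + v (b : k) ≤ R' :=
    fun v => (hR ⟨v, rfl⟩).trans (le_max_left _ _)
  have hR1 : 1 ≤ R' := le_max_right _ _
  refine ⟨c, hc, R' * K ^ d, one_le_mul_of_one_le_of_one_le hR1 (one_le_pow₀ hK), fun M hM => ?_⟩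
  obtain ⟨T, hTcard, hT⟩ := hT M hM
  refine ⟨T.image fun u => b * u + τ₀, ?_, ?_⟩
  · rwa [Finset.card_image_of_injective]
    intro u u' h
    exact mul_left_cancel₀ hb0 (add_right_cancel h)
  · intro τ hτ
    obtain ⟨u, hu, rfl⟩ := Finset.mem_image.1 hτ
    obtain ⟨w, η, hη0, rfl, hw, hη, hval⟩ := hT u hu
    have hηk : (η : k) ≠ 0 := by simpa using hη0
    have heval : A.eval (b * ((w : k) / η) + τ₀) =
        ∑ i ∈ Finset.range (d + 1), α i * (b * ((w : k) / η)) ^ i := by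
      rw [← taylor_eval, eval_eq_sum_range, natDegree_taylor]
    constructor
    · intro q hq
      rw [heval]
      refine Valuation.map_sum_le _ fun i hi => ?_
      have hu1 : q.valuation k ((w : k) / η) ≤ 1 := by
        rw [map_div₀, hval q hq, div_one]; exact q.valuation_le_one w
      rcases i with _ | i
      -- The constant term is A(τ₀), integral outside P by hypothesis rather than through b.
      · simpa [α, taylor_coeff_zero] using hτ₀ q hq
      · have : α (i + 1) * (b * ((w : k) / η)) ^ (i + 1) =
            (β (i + 1) : k) * (b : k) ^ i * ((w : k) / η) ^ (i + 1) := by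
          rw [hβ _ hi]; ring
        rw [this, map_mul, map_mul, map_pow, map_pow]
        exact mul_le_one' (mul_le_one' (q.valuation_le_one _) (pow_le_one' (q.valuation_le_one _) _))
          (pow_le_one' hu1 _)
    -- A(τ) is written over the common denominator b·η^d; the extra b is needed for the constant
    -- coefficient.
    · set x : 𝓞 k := ∑ i ∈ Finset.range (d + 1), β i * b ^ i * w ^ i * η ^ (d - i)
      set y : 𝓞 k := b * η ^ d
      have hx : (x : k) = ∑ i ∈ Finset.range (d + 1),
          (β i : k) * (b : k) ^ i * (w : k) ^ i * (η : k) ^ (d - i) := by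
        simp only [x, RingOfIntegers.coe_eq_algebraMap, map_sum, map_mul, map_pow]
      have hxy : A.eval (b * ((w : k) / η) + τ₀) = x / y := by
        rw [heval, eq_div_iff (by simp only [y]; push_cast; exact mul_ne_zero hb0 (pow_ne_zero _ hηk))]
        rw [hx, Finset.sum_mul]
        simp only [y]
        push_cast
        refine Finset.sum_congr rfl fun i hi => ?_
        have hid : i ≤ d := Nat.lt_succ_iff.1 (Finset.mem_range.1 hi)
        rw [hβ i hi, ← Nat.sub_add_cancel hid, pow_add, Nat.add_sub_cancel, mul_pow, div_pow]
        field_simp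
      rw [hxy]
      have hKM : 0 ≤ K * M := by positivity
      have hKMd : 0 ≤ (K * M) ^ d := by positivity
      refine mulHeight₁_div_le (mul_ne_zero (nonZeroDivisors.ne_zero hb) (pow_ne_zero _ hη0))
        (fun v => ?_) fun v => ?_
      · have h1 : v (x : k) ≤ ∑ i ∈ Finset.range (d + 1),
            v ((β i : k) * (b : k) ^ i) * (K * M) ^ d := by
          rw [hx]
          refine (AbsoluteValue.sum_le v.1 _ _).trans (Finset.sum_le_sum fun i hi => ?_)
          have hid : i ≤ d := Nat.lt_succ_iff.1 (Finset.mem_range.1 hi)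
          have e : v.1 ((β i : k) * (b : k) ^ i * (w : k) ^ i * (η : k) ^ (d - i)) =
              v ((β i : k) * (b : k) ^ i) * (v (w : k) ^ i * v (η : k) ^ (d - i)) := by
            change v _ = _
            simp only [map_mul, map_pow]
            ring
          rw [e, ← Nat.add_sub_cancel' hid, pow_add (K * M), Nat.add_sub_cancel' hid]
          refine mul_le_mul_of_nonneg_left (mul_le_mul ?_ ?_ (by positivity) (by positivity))
            (apply_nonneg _ _)
          · exact pow_le_pow_left₀ (apply_nonneg _ _) (hw v) _
          · exact pow_le_pow_left₀ (apply_nonneg _ _) (hη v) _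
        rw [← Finset.sum_mul] at h1
        rw [mul_assoc, ← mul_pow]
        exact h1.trans (mul_le_mul_of_nonneg_right
          ((le_add_of_nonneg_right (apply_nonneg _ _)).trans (hR' v)) hKMd)
      · have e : v (y : k) = v (b : k) * v (η : k) ^ d := by
          simp only [y]; push_cast; rw [map_mul, map_pow]
        rw [e, mul_assoc, ← mul_pow]
        refine mul_le_mul ?_ (pow_le_pow_left₀ (apply_nonneg _ _) (hη v) _)
          (pow_nonneg (apply_nonneg _ _) _) (by positivity)
        exact (le_add_of_nonneg_left (Finset.sum_nonneg fun i _ => apply_nonneg _ _)).trans (hR' v)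

/-- Northcott's theorem. Finiteness matters because `Set.ncard` is 0 on infinite sets, so comparing
cardinalities by inclusion requires it. -/
theorem finite_newInputs (f g : k[X]) (S : Finset (NFPlace k)) (B : ℝ) :
    (newInputs f g S B).Finite := by
  refine (finite_setOfPred_mulHeight₁_le k (max B 0 ^ Module.finrank ℚ k)).subset fun a ha => ?_
  have h := ha.2.1.trans (le_max_left B 0)
  have hn : (Module.finrank ℚ k : ℝ) ≠ 0 := by exact_mod_cast Module.finrank_pos.ne'
  have h1 := Real.rpow_le_rpow (Real.rpow_nonneg (Height.mulHeight₁_nonneg a) _) h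
    (Nat.cast_nonneg (Module.finrank ℚ k))
  rwa [← Real.rpow_mul (Height.mulHeight₁_nonneg a), one_div_mul_cancel hn,
    Real.rpow_one, Real.rpow_natCast] at h1

/-- A polynomial has only finitely many decompositions `f = g ∘ h` with `g` given. -/
theorem finite_right_factors {F : Type*} [Field F] (f g : F[X]) (hg : g.natDegree ≠ 0) :
    {h : F[X] | f = g.comp h}.Finite := by
  -- The h in question are the roots in F[x] of g(T) - f, a nonzero polynomial in T because g is
  -- nonconstant.
  set G : F[X][X] := g.map C - C f
  have hG : G ≠ 0 := fun h0 => hg <| by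
    have : (g.map C).natDegree = (C f : F[X][X]).natDegree := by rw [sub_eq_zero.1 h0]
    rwa [natDegree_map, natDegree_C] at this
  refine (G.finite_setOfPred_isRoot hG).subset fun h hh => ?_
  simp only [Set.mem_ofPred_eq, IsRoot.def, G, eval_sub, eval_C, eval_map]
  exact sub_eq_zero.2 hh.symm

theorem exists_many_newInputs (S : Finset (NFPlace k)) (hS : ∀ v : InfinitePlace k, Sum.inl v ∈ S)
    {f g A D : k[X]} {τ₀ : k} (hg : g.natDegree ≠ 0) (hA : A.natDegree ≠ 0)
    (hfg : f.comp A = g.comp D) (hD : ∀ h : k[X], f = g.comp h → D ≠ h.comp A)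
    (hτ₀ : A.eval τ₀ ∈ sIntegers S) :
    ∃ c : ℝ, 0 < c ∧ ∃ K : ℝ, 1 ≤ K ∧ ∃ M₀ : ℕ, ∀ M : ℕ, M₀ ≤ M →
      c * ((M : ℝ) ^ Module.finrank ℚ k * Real.log M ^ (S.card - 1)) ≤
        newCount f g S (K * (M : ℝ) ^ A.natDegree) := by
  classical
  set P := S.toRight
  have hPS : ∀ q : HeightOneSpectrum (𝓞 k), q ∉ P ↔ Sum.inr q ∉ S := fun q => by simp [P]
  -- The unit rank is the number of Archimedean places minus one, and S contains all of them.
  have hcard : Units.rank k + P.card = S.card - 1 := by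
    have h1 : S.toLeft = Finset.univ := by ext v; simp [hS v]
    have h2 := S.card_toLeft_add_card_toRight
    rw [h1, Finset.card_univ] at h2
    have h3 : 0 < Fintype.card (InfinitePlace k) := Fintype.card_pos
    simp only [Units.rank, P]
    omega
  obtain ⟨c, hc, K, hK, hT⟩ := exists_many_integral_values P A τ₀ fun q hq => hτ₀ q ((hPS q).1 hq)
  rw [hcard] at hT
  set n := Module.finrank ℚ k
  have hn : n ≠ 0 := Module.finrank_pos.ne'
  set d := A.natDegree
  have hbad : (⋃ h ∈ {h : k[X] | f = g.comp h}, {τ : k | (D - h.comp A).IsRoot τ}).Finite :=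
    (finite_right_factors f g hg).biUnion fun h hh =>
      finite_setOfPred_isRoot (sub_ne_zero.2 (hD h hh))
  set Z := hbad.toFinset
  have hd : (0 : ℝ) < d := by exact_mod_cast Nat.pos_of_ne_zero hA
  -- Beyond M₁ the exceptional set Z is at most half of the main term; M ≥ 3 ensures log M ≥ 1.
  obtain ⟨M₁, hM₁⟩ := exists_nat_ge (2 * Z.card / c : ℝ)
  refine ⟨c / (2 * d), by positivity, K, hK, max M₁ 3, fun M hM => ?_⟩
  have hM3 : 3 ≤ M := (le_max_right _ _).trans hM
  have hM1' : (M₁ : ℝ) ≤ M := by exact_mod_cast (le_max_left _ _).trans hM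
  have hM3' : (3 : ℝ) ≤ M := by exact_mod_cast hM3
  obtain ⟨T, hTcard, hT⟩ := hT M (by omega)
  have hlog : 1 ≤ Real.log M := by
    rw [Real.le_log_iff_exp_le (by linarith)]
    exact (Real.exp_one_lt_d9.le).trans (by linarith)
  have hbig : (M : ℝ) ≤ (M : ℝ) ^ n * Real.log M ^ (S.card - 1) :=
    (le_self_pow₀ (by linarith) hn).trans (le_mul_of_one_le_right (by positivity) (one_le_pow₀ hlog))
  have hZ : 2 * (Z.card : ℝ) ≤ c * ((M : ℝ) ^ n * Real.log M ^ (S.card - 1)) := by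
    have := (hM₁.trans hM1').trans hbig
    rwa [div_le_iff₀' hc] at this
  have hsub : (((T \ Z).image fun τ => A.eval τ : Finset k) : Set k) ⊆
      newInputs f g S (K * (M : ℝ) ^ d) := by
    intro a ha
    obtain ⟨τ, hτ, rfl⟩ := Finset.mem_image.1 (Finset.mem_coe.1 ha)
    rw [Finset.mem_sdiff] at hτ
    obtain ⟨hτT, hτZ⟩ := hτ
    refine ⟨fun q hq => (hT τ hτT).1 q ((hPS q).2 hq), ?_, D.eval τ, ?_, fun h hh heq => hτZ ?_⟩
    · rw [absHeight]
      refine (Real.rpow_le_rpow (Height.mulHeight₁_nonneg _) (hT τ hτT).2 (by positivity)).trans ?_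
      rw [one_div, Real.pow_rpow_inv_natCast (by positivity) hn]
    · rw [← eval_comp, ← eval_comp, hfg]
    · simp only [Z, Set.Finite.mem_toFinset, Set.mem_iUnion]
      exact ⟨h, hh, by simp [IsRoot.def, eval_comp, heq]⟩
  have h1 := Set.ncard_le_ncard hsub (finite_newInputs f g S _)
  rw [Set.ncard_coe_finset] at h1
  have h2 : (T \ Z).card ≤ d * ((T \ Z).image fun τ => A.eval τ).card := by
    refine Finset.card_le_mul_card_image _ _ fun a _ => ?_
    have hAa : A - C a ≠ 0 := fun h0 => hA (by
      simp only [d]; rw [sub_eq_zero.1 h0, natDegree_C])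
    calc _ ≤ (A - C a).roots.toFinset.card := Finset.card_le_card fun τ hτ => by
          rw [Multiset.mem_toFinset, mem_roots hAa]
          simp [(Finset.mem_filter.1 hτ).2]
      _ ≤ (A - C a).natDegree := (Multiset.toFinset_card_le _).trans (card_roots' _)
      _ = d := natDegree_sub_C
  have h3 : T.card ≤ (T \ Z).card + Z.card := by
    have := Finset.le_card_sdiff Z T
    omega
  have h4 : (T.card : ℝ) ≤ d * newCount f g S (K * (M : ℝ) ^ d) + Z.card := by
    have := h3.trans (Nat.add_le_add_right (h2.trans (Nat.mul_le_mul_left d h1)) _)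
    exact_mod_cast this
  rw [div_mul_eq_mul_div, div_le_iff₀ (by positivity)]
  linarith

end Values

/-! ### Comparison of power-log growth rates -/

section Growth

/-- A lower bound along the sequence `K M ^ d` gives a lower bound for all large arguments. -/
theorem lower_bound_of_subsequence {N : ℝ → ℝ} (hN : Monotone N) {c K : ℝ} (hc : 0 < c)
    (hK : 1 ≤ K) {d : ℕ} (hd : d ≠ 0) (n r M₀ : ℕ)
    (h : ∀ M : ℕ, M₀ ≤ M → c * ((M : ℝ) ^ n * Real.log M ^ r) ≤ N (K * (M : ℝ) ^ d)) :
    ∃ c' : ℝ, 0 < c' ∧ ∃ B₀ : ℝ, ∀ B : ℝ, B₀ ≤ B →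
      c' * (B ^ ((n : ℝ) / d) * Real.log (2 * B) ^ r) ≤ N B := by
  have hd' : (0 : ℝ) < d := by exact_mod_cast Nat.pos_of_ne_zero hd
  -- The real solution of K·x^d = B; its floor serves as M.
  set x : ℝ → ℝ := fun B => (B / K) ^ (1 / (d : ℝ))
  have hx : Tendsto x atTop atTop :=
    (tendsto_rpow_atTop (by positivity)).comp (tendsto_id.atTop_div_const (by linarith))
  have hlogB : Tendsto (fun B : ℝ => Real.log B) atTop atTop := Real.tendsto_log_atTop
  -- The second condition gives M ≥ M₀ and M ≥ x/2; the third is log(x/2) ≥ log(2B)/(2d) rearranged.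
  have hev : ∀ᶠ B : ℝ in atTop, 1 ≤ B ∧ (M₀ : ℝ) + 2 ≤ x B ∧
      2 * Real.log K + 2 * d * Real.log 2 + Real.log 2 ≤ Real.log B :=
    (eventually_ge_atTop 1).and ((hx.eventually_ge_atTop _).and (hlogB.eventually_ge_atTop _))
  obtain ⟨B₀, hB₀⟩ := eventually_atTop.1 hev
  refine ⟨c * ((1 / 2) ^ n * (K ^ ((n : ℝ) / d))⁻¹ * (1 / (2 * d)) ^ r), by positivity, B₀,
    fun B hB => ?_⟩
  obtain ⟨hB1, hxB, hlB⟩ := hB₀ B hB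
  have hBK : 0 < B / K := by positivity
  set M := ⌊x B⌋₊
  have hxpos : 0 < x B := Real.rpow_pos_of_pos hBK _
  have hMle : (M : ℝ) ≤ x B := Nat.floor_le hxpos.le
  have hMlt : x B < M + 1 := Nat.lt_floor_add_one _
  have hM0 : (0 : ℝ) ≤ M₀ := Nat.cast_nonneg _
  have hMM₀ : M₀ ≤ M := Nat.le_floor (by linarith)
  have hhalf : x B / 2 ≤ M := by linarith
  have hxd : x B ^ d = B / K := by
    simp only [x, one_div]
    exact Real.rpow_inv_natCast_pow hBK.le hd
  have hxn : x B ^ n = B ^ ((n : ℝ) / d) * (K ^ ((n : ℝ) / d))⁻¹ := by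
    simp only [x]
    rw [← Real.rpow_natCast, ← Real.rpow_mul hBK.le, one_div_mul_eq_div,
      Real.div_rpow (by linarith) (by linarith), div_eq_mul_inv]
  have hlogx : Real.log (x B) = (Real.log B - Real.log K) / d := by
    simp only [x]
    rw [Real.log_rpow hBK, Real.log_div (by positivity) (by positivity)]
    ring
  have hlog2B : 0 ≤ Real.log (2 * B) := Real.log_nonneg (by linarith)
  have hlogM : 1 / (2 * d) * Real.log (2 * B) ≤ Real.log M := by
    refine le_trans ?_ (Real.log_le_log (by positivity) hhalf)
    rw [Real.log_div hxpos.ne' two_ne_zero, hlogx, Real.log_mul two_ne_zero (by positivity),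
      ← sub_nonneg]
    have : (Real.log B - Real.log K) / d - Real.log 2 - 1 / (2 * d) * (Real.log 2 + Real.log B) =
        (Real.log B - (2 * Real.log K + 2 * d * Real.log 2 + Real.log 2)) / (2 * d) := by
      field_simp; ring
    rw [this]
    exact div_nonneg (by linarith) (by positivity)
  have hKM : K * (M : ℝ) ^ d ≤ B := by
    have := pow_le_pow_left₀ (Nat.cast_nonneg M) hMle d
    rw [hxd, le_div_iff₀ (by linarith)] at this
    linarith
  refine le_trans ?_ ((h M hMM₀).trans (hN hKM))
  have e : c * ((1 / 2) ^ n * (K ^ ((n : ℝ) / d))⁻¹ * (1 / (2 * d)) ^ r) *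
      (B ^ ((n : ℝ) / d) * Real.log (2 * B) ^ r) =
      c * ((x B / 2) ^ n * (1 / (2 * d) * Real.log (2 * B)) ^ r) := by
    rw [div_pow (x B), hxn, mul_pow, div_pow 1 2, one_pow]; ring
  rw [e]
  gcongr

/-- If (γ, r) exceeded (α, β) lexicographically, the quotient of the two power-log functions would
tend to infinity. -/
theorem exponents_le_of_isBigO {N : ℝ → ℝ} {c γ : ℝ} (hc : 0 < c) (r : ℕ) {B₀ : ℝ}
    (h : ∀ B : ℝ, B₀ ≤ B → c * (B ^ γ * Real.log (2 * B) ^ r) ≤ N B) {α β : ℝ}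
    (hO : N =O[atTop] fun B : ℝ => B ^ α * Real.log (2 * B) ^ β) :
    γ < α ∨ (γ = α ∧ (r : ℝ) ≤ β) := by
  have hlog : Tendsto (fun B : ℝ => Real.log (2 * B)) atTop atTop :=
    Real.tendsto_log_atTop.comp (tendsto_id.const_mul_atTop two_pos)
  have hO' : (fun B : ℝ => B ^ γ * Real.log (2 * B) ^ (r : ℝ)) =O[atTop]
      fun B : ℝ => B ^ α * Real.log (2 * B) ^ β := by
    refine IsBigO.trans ?_ hO
    refine IsBigO.of_bound c⁻¹ ?_
    filter_upwards [eventually_ge_atTop B₀, eventually_ge_atTop 1, hlog.eventually_ge_atTop 0]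
      with B hB hB1 hlB
    have h0 : 0 ≤ B ^ γ * Real.log (2 * B) ^ r := by positivity
    have h1 := h B hB
    rw [Real.rpow_natCast, Real.norm_of_nonneg h0, Real.norm_of_nonneg (by nlinarith),
      ← div_eq_inv_mul, le_div_iff₀ hc]
    linarith
  have hcontra : ∀ {δ : ℝ → ℝ}, Tendsto δ atTop atTop →
      (∀ᶠ B in atTop, δ B * ‖B ^ α * Real.log (2 * B) ^ β‖ ≤
        ‖B ^ γ * Real.log (2 * B) ^ (r : ℝ)‖) → False := by
    intro δ hδ hle
    obtain ⟨C, hC⟩ := hO'.bound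
    obtain ⟨B, h1, h2, h3, h4, h5⟩ := (hC.and (hle.and ((hδ.eventually_gt_atTop C).and
      ((eventually_ge_atTop 1).and (hlog.eventually_gt_atTop 0))))).exists
    have : 0 < ‖B ^ α * Real.log (2 * B) ^ β‖ := norm_pos_iff.2 (by positivity)
    nlinarith
  rcases lt_trichotomy γ α with hlt | heq | hgt
  · exact Or.inl hlt
  · refine Or.inr ⟨heq, ?_⟩
    by_contra! hβ
    refine hcontra ((tendsto_rpow_atTop (sub_pos.2 hβ)).comp hlog) ?_
    filter_upwards [eventually_ge_atTop 1, hlog.eventually_gt_atTop 0] with B hB hlB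
    rw [Real.norm_of_nonneg (by positivity), Real.norm_of_nonneg (by positivity), heq,
      Function.comp_apply, Real.rpow_sub hlB]
    refine le_of_eq ?_
    field_simp
  · exfalso
    -- Half of the gap γ - α absorbs the power of the logarithm, whatever its sign; the other half
    -- diverges.
    have hlo : (fun B : ℝ => Real.log (2 * B) ^ (β - r)) =o[atTop]
        fun B : ℝ => (2 * B) ^ ((γ - α) / 2) :=
      (isLittleO_log_rpow_rpow_atTop (β - r) (half_pos (sub_pos.2 hgt))).comp_tendsto
        (tendsto_id.const_mul_atTop two_pos)
    refine hcontra (δ := fun B => (2 ^ ((γ - α) / 2))⁻¹ * B ^ ((γ - α) / 2))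
      ((tendsto_rpow_atTop (half_pos (sub_pos.2 hgt))).const_mul_atTop (by positivity)) ?_
    filter_upwards [eventually_ge_atTop 1, hlog.eventually_gt_atTop 0, hlo.bound one_pos]
      with B hB hlB hb
    have hB0 : 0 < B := by linarith
    rw [Real.norm_of_nonneg (by positivity), Real.norm_of_nonneg (by positivity), one_mul,
      Real.mul_rpow (by norm_num) hB0.le, Real.rpow_sub hlB, div_le_iff₀ (by positivity)] at hb
    rw [Real.norm_of_nonneg (by positivity), Real.norm_of_nonneg (by positivity)]
    have e : B ^ γ = B ^ α * (B ^ ((γ - α) / 2) * B ^ ((γ - α) / 2)) := by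
      rw [← Real.rpow_add hB0, ← Real.rpow_add hB0]; congr 1; ring
    calc _ ≤ (2 ^ ((γ - α) / 2))⁻¹ * B ^ ((γ - α) / 2) * (B ^ α *
          (2 ^ ((γ - α) / 2) * B ^ ((γ - α) / 2) * Real.log (2 * B) ^ (r : ℝ))) := by gcongr
      _ = _ := by rw [e]; field_simp

end Growth

end SparseLifting

noncomputable section

namespace SparseLifting

/-! ### Laurent expansions and the places they define -/

section Laurent

variable (F : Type*) [Field F]

/-- The valuation ring `F⟦s⟧` of the field `F⸨s⸩`. -/
def powerSeriesSubring : ValuationSubring (LaurentSeries F) where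
  __ := (HahnSeries.ofPowerSeries ℤ F).range
  mem_or_inv_mem' z := by
    change z ∈ (HahnSeries.ofPowerSeries ℤ F).range ∨ z⁻¹ ∈ (HahnSeries.ofPowerSeries ℤ F).range
    rcases le_total (Valued.v z) (1 : WithZero (Multiplicative ℤ)) with h | h
    · exact Or.inl ((LaurentSeries.val_le_one_iff_eq_coe F z).1 h)
    · refine Or.inr ((LaurentSeries.val_le_one_iff_eq_coe F z⁻¹).1 ?_)
      rw [map_inv₀]
      exact inv_le_one_of_one_le₀ h

variable {F}

theorem mem_powerSeriesSubring {z : LaurentSeries F} :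
    z ∈ powerSeriesSubring F ↔ ∃ p : PowerSeries F, HahnSeries.ofPowerSeries ℤ F p = z := Iff.rfl

theorem ofPowerSeries_coeff_zero (p : PowerSeries F) :
    (HahnSeries.ofPowerSeries ℤ F p).coeff 0 = PowerSeries.constantCoeff p := by
  simpa using HahnSeries.ofPowerSeries_apply_coeff (Γ := ℤ) p 0

/-- The constant term of a power series, seen in the Laurent series field. -/
def constTerm : powerSeriesSubring F →+* F where
  toFun z := (z : LaurentSeries F).coeff 0
  map_one' := by simp
  map_zero' := by simp
  map_add' z w := by simp
  map_mul' := by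
    rintro ⟨_, p, rfl⟩ ⟨_, q, rfl⟩
    change ((HahnSeries.ofPowerSeries ℤ F p) * (HahnSeries.ofPowerSeries ℤ F q)).coeff 0 =
      (HahnSeries.ofPowerSeries ℤ F p).coeff 0 * (HahnSeries.ofPowerSeries ℤ F q).coeff 0
    rw [← map_mul, ofPowerSeries_coeff_zero, ofPowerSeries_coeff_zero, ofPowerSeries_coeff_zero,
      map_mul]

variable {K : Type*} [Field K] (ψ : K →+* LaurentSeries F)

/-- The constant term of the expansions of the elements of `K` along `ψ`. -/
def expansionConstTerm : (powerSeriesSubring F).comap ψ →+* F :=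
  constTerm.comp (ψ.restrict ((powerSeriesSubring F).comap ψ) (powerSeriesSubring F) fun _ h => h)

theorem expansionConstTerm_apply (z : (powerSeriesSubring F).comap ψ) :
    expansionConstTerm ψ z = (ψ z).coeff 0 := rfl

/-- A power series with nonzero constant term is invertible. Locality lets the constant term descend
to the residue field, where it becomes the embedding of a geometric point. -/
instance : IsLocalHom (expansionConstTerm ψ) where
  map_nonunit := by
    rintro ⟨z, hz⟩ hu
    obtain ⟨p, hp⟩ := mem_powerSeriesSubring.1 (ValuationSubring.mem_comap.1 hz)
    rw [expansionConstTerm_apply, ← hp, ofPowerSeries_coeff_zero, isUnit_iff_ne_zero] at hu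
    have hmul : ψ z * HahnSeries.ofPowerSeries ℤ F p⁻¹ = 1 := by
      rw [← hp, ← map_mul, PowerSeries.mul_inv_cancel p hu, map_one]
    have hinv : z⁻¹ ∈ (powerSeriesSubring F).comap ψ := by
      rw [ValuationSubring.mem_comap, map_inv₀, ← eq_inv_of_mul_eq_one_right hmul]
      exact mem_powerSeriesSubring.2 ⟨_, rfl⟩
    have hz0 : z ≠ 0 := by rintro rfl; simp at hmul
    exact IsUnit.of_mul_eq_one ⟨z⁻¹, hinv⟩ (Subtype.ext (mul_inv_cancel₀ hz0))

end Laurent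

section RatFuncExpansion

variable {k F : Type*} [Field k] [Field F] [Algebra k F]

/-- The expansion of polynomials at the point `α`. -/
def polynomialExpansion (α : F) : k[X] →+* LaurentSeries F :=
  (HahnSeries.ofPowerSeries ℤ F).comp <| (Polynomial.coeToPowerSeries.ringHom).comp <|
    (taylorEquiv α : F[X] →+* F[X]).comp (mapRingHom (algebraMap k F))

theorem polynomialExpansion_apply (α : F) (p : k[X]) :
    polynomialExpansion α p =
      HahnSeries.ofPowerSeries ℤ F (taylor α (p.map (algebraMap k F)) : F[X]) := rfl

theorem polynomialExpansion_injective (α : F) :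
    Function.Injective (polynomialExpansion (k := k) α) := by
  intro p q h
  rw [polynomialExpansion_apply, polynomialExpansion_apply] at h
  exact map_injective _ (algebraMap k F).injective <| taylor_injective α <|
    Polynomial.coe_injective F <| HahnSeries.ofPowerSeries_injective h

/-- The expansion of rational functions at the point `α`. -/
def ratFuncExpansion (α : F) : RatFunc k →+* LaurentSeries F :=
  IsFractionRing.lift (polynomialExpansion_injective (k := k) α)

theorem ratFuncExpansion_algebraMap (α : F) (p : k[X]) :
    ratFuncExpansion α (algebraMap k[X] (RatFunc k) p) = polynomialExpansion α p :=
  IsFractionRing.lift_algebraMap _ _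

theorem polynomialExpansion_mem (α : F) (p : k[X]) :
    polynomialExpansion α p ∈ powerSeriesSubring F := mem_powerSeriesSubring.2 ⟨_, rfl⟩

theorem polynomialExpansion_coeff_zero (α : F) (p : k[X]) :
    (polynomialExpansion α p).coeff 0 = aeval α p := by
  rw [polynomialExpansion_apply, ofPowerSeries_coeff_zero,
    ← PowerSeries.coeff_zero_eq_constantCoeff_apply, Polynomial.coeff_coe, taylor_coeff_zero,
    eval_map_algebraMap]

/-- If z were regular at α, constant terms in z · denom = num would give num(α) = 0, contradicting
coprimality. -/
theorem ratFuncExpansion_notMem {α : F} {z : RatFunc k} (h : aeval α z.denom = 0) :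
    ratFuncExpansion α z ∉ powerSeriesSubring F := by
  intro hz
  have hmul : z * algebraMap k[X] (RatFunc k) z.denom = algebraMap k[X] (RatFunc k) z.num := by
    conv_lhs => rw [← RatFunc.num_div_denom z]
    rw [RatFunc.num_div_denom]
    nth_rw 1 [← RatFunc.num_div_denom z]
    exact div_mul_cancel₀ _ (RatFunc.algebraMap_ne_zero z.denom_ne_zero)
  have h1 := congrArg (ratFuncExpansion α) hmul
  rw [map_mul, ratFuncExpansion_algebraMap, ratFuncExpansion_algebraMap] at h1
  have h2 := map_mul (constTerm (F := F)) ⟨_, hz⟩ ⟨_, polynomialExpansion_mem α z.denom⟩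
  have h3 : (polynomialExpansion α z.num).coeff 0 =
      (ratFuncExpansion α z).coeff 0 * (polynomialExpansion α z.denom).coeff 0 := by
    rw [← h1]; exact h2
  rw [polynomialExpansion_coeff_zero, polynomialExpansion_coeff_zero, h, mul_zero] at h3
  obtain ⟨u, v, huv⟩ := z.isCoprime_num_denom
  have := congrArg (aeval α) huv
  simp [h, h3] at this

end RatFuncExpansion

namespace Component

variable {k : Type*} [Field k] {f g : k[X]} (C : Component f g)

/-- The function `X` on `C`. -/
def funX : C.FunctionField := algebraMap C.CoordRing C.FunctionField C.coordX

/-- The function `Y` on `C`. -/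
def funY : C.FunctionField :=
  algebraMap C.CoordRing C.FunctionField (Ideal.Quotient.mk C.ideal (MvPolynomial.X 1))

theorem aeval_funX_eq_aeval_funY : aeval C.funX f = aeval C.funY g := by
  have h : curvePoly f g ∈ C.ideal := C.mem_minimalPrimes.1.2 (Ideal.subset_span rfl)
  have h1 := Ideal.Quotient.eq_zero_iff_mem.2 h
  rw [curvePoly, map_sub, sub_eq_zero] at h1
  have h2 := congrArg (algebraMap C.CoordRing C.FunctionField) h1
  have e (p : k[X]) (i : Fin 2) : algebraMap C.CoordRing C.FunctionField
      (Ideal.Quotient.mk C.ideal (aeval (MvPolynomial.X i) p)) =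
      aeval (algebraMap C.CoordRing C.FunctionField
        (Ideal.Quotient.mk C.ideal (MvPolynomial.X i))) p := by
    rw [aeval_algebraMap_apply]
    congr 1
    exact (aeval_algHom_apply (Ideal.Quotient.mkₐ k C.ideal) (MvPolynomial.X i) p).symm
  rwa [e, e] at h2

theorem funX_mem_normalization : C.funX ∈ C.Normalization := Subalgebra.algebraMap_mem _ _

/-- An embedding of the function field into a Laurent series field over the algebraic closure
under which `X` has a pole gives a geometric boundary point. -/
def GeomBoundaryPoint.ofExpansion (ψ : C.FunctionField →+* LaurentSeries (AlgebraicClosure k))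
    (hconst : ∀ c : k, ψ (algebraMap k C.FunctionField c) ∈ powerSeriesSubring (AlgebraicClosure k) ∧
      (ψ (algebraMap k C.FunctionField c)).coeff 0 = algebraMap k (AlgebraicClosure k) c)
    (hpole : ψ C.funX ∉ powerSeriesSubring (AlgebraicClosure k)) : C.GeomBoundaryPoint where
  place := (powerSeriesSubring (AlgebraicClosure k)).comap ψ
  const_mem c := (hconst c).1
  atInfinity := ⟨C.funX, C.funX_mem_normalization, hpole⟩
  emb := IsLocalRing.ResidueField.lift (expansionConstTerm ψ)
  emb_const c := (hconst c).2

/-- The residue of the coordinate recovers α, so distinct poles of X yield distinct boundary points.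
-/
theorem exists_boundaryPoint (φ : C.FunctionField ≃ₐ[k] RatFunc k) {α : AlgebraicClosure k}
    (hα : aeval α (φ C.funX).denom = 0) :
    ∃ P : C.GeomBoundaryPoint, ∃ h : φ.symm RatFunc.X ∈ P.place,
      P.emb (IsLocalRing.residue P.place ⟨_, h⟩) = α := by
  set ψ : C.FunctionField →+* LaurentSeries (AlgebraicClosure k) :=
    (ratFuncExpansion α).comp (φ : C.FunctionField →+* RatFunc k)
  have hψ (p : k[X]) : ψ (φ.symm (algebraMap k[X] (RatFunc k) p)) = polynomialExpansion α p := by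
    simp only [ψ, RingHom.comp_apply, RingHom.coe_coe, AlgEquiv.apply_symm_apply]
    exact ratFuncExpansion_algebraMap α p
  have hc (c : k) : algebraMap k C.FunctionField c =
      φ.symm (algebraMap k[X] (RatFunc k) (Polynomial.C c)) := by
    rw [← φ.symm.commutes, IsScalarTower.algebraMap_apply k k[X] (RatFunc k)]; rfl
  refine ⟨GeomBoundaryPoint.ofExpansion C ψ (fun c => ?_) (ratFuncExpansion_notMem hα), ?_, ?_⟩
  · rw [hc, hψ]
    exact ⟨polynomialExpansion_mem _ _, by rw [polynomialExpansion_coeff_zero, aeval_C]⟩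
  · change ψ _ ∈ powerSeriesSubring (AlgebraicClosure k)
    rw [← RatFunc.algebraMap_X, hψ]
    exact polynomialExpansion_mem _ _
  · change (ψ (φ.symm RatFunc.X)).coeff 0 = α
    rw [← RatFunc.algebraMap_X, hψ, polynomialExpansion_coeff_zero, aeval_X]

end Component

end SparseLifting

noncomputable section

/-! ### Polynomial parametrization of a component with one point at infinity -/

namespace SparseLifting

/-- z is a root of p - r, which becomes monic after division by the leading coefficient in k. -/
theorem isIntegral_of_aeval_eq_algebraMap {k R K : Type*} [Field k] [CommRing R] [CommRing K]
    [Algebra k R] [Algebra R K] [Algebra k K] [IsScalarTower k R K] {p : k[X]}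
    (hp : p.natDegree ≠ 0) {z : K} {r : R} (h : aeval z p = algebraMap R K r) : IsIntegral R z := by
  have hint : IsIntegral R (aeval z p) := h ▸ isIntegral_algebraMap
  have hp0 : p.leadingCoeff ≠ 0 := leadingCoeff_ne_zero.2 fun h0 => hp (by simp [h0])
  refine ⟨(C p.leadingCoeff⁻¹ * p).map (algebraMap k R) - C (algebraMap k R p.leadingCoeff⁻¹ * r),
    ?_, ?_⟩
  · have hm : (C p.leadingCoeff⁻¹ * p).Monic := by
      rw [mul_comm]; exact monic_mul_leadingCoeff_inv fun h0 => hp (by simp [h0])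
    rcases subsingleton_or_nontrivial R with hR | hR
    · exact Subsingleton.elim _ _
    refine (hm.map _).sub_of_left (lt_of_le_of_lt degree_C_le ?_)
    rw [hm.degree_map, degree_C_mul (inv_ne_zero hp0)]
    exact natDegree_pos_iff_degree_pos.1 (Nat.pos_of_ne_zero hp)
  · rw [← aeval_def]
    simp only [map_sub, aeval_map_algebraMap, map_mul, aeval_C, h]
    rw [← IsScalarTower.algebraMap_apply k R K, sub_self]

/-- The minimal polynomial of α divides p, so α is its only root; being separable, it has degree 1.
-/
theorem exists_algebraMap_eq_of_unique_root {k : Type*} [Field k] [CharZero k] {p : k[X]}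
    {α : AlgebraicClosure k} (hα : aeval α p = 0)
    (huniq : ∀ β : AlgebraicClosure k, aeval β p = 0 → β = α) :
    ∃ c : k, algebraMap k (AlgebraicClosure k) c = α := by
  have hint : IsIntegral k α := Algebra.IsIntegral.isIntegral α
  have hsub : Subsingleton ((minpoly k α).rootSet (AlgebraicClosure k)) := by
    have key : ∀ β ∈ (minpoly k α).rootSet (AlgebraicClosure k), β = α := fun β hβ => by
      obtain ⟨q, hq⟩ := minpoly.dvd k α hα
      refine huniq β ?_
      rw [hq, map_mul, (mem_rootSet.1 hβ).2, zero_mul]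
    exact ⟨fun a b => Subtype.ext ((key _ a.2).trans (key _ b.2).symm)⟩
  have hcard := card_rootSet_eq_natDegree (K := AlgebraicClosure k)
    (minpoly.irreducible hint).separable (IsAlgClosed.splits _)
  have hle := Fintype.card_le_one_iff_subsingleton.2 hsub
  have hdeg : (minpoly k α).natDegree = 1 :=
    le_antisymm (hcard ▸ hle) (minpoly.natDegree_pos hint)
  exact minpoly.mem_range_of_degree_eq_one k α (by
    rw [degree_eq_natDegree (minpoly.ne_zero hint), hdeg]; rfl)

/-- The automorphism of `k(t)` with `t ↦ c + 1 / t`. -/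
theorem exists_algEquiv_inversion {k : Type*} [Field k] (c : k) :
    ∃ e : RatFunc k ≃ₐ[k] RatFunc k, e RatFunc.X = RatFunc.C c + (RatFunc.X)⁻¹ := by
  set z : RatFunc k := RatFunc.C c + (RatFunc.X)⁻¹
  have hX : (RatFunc.X : RatFunc k) = (z - RatFunc.C c)⁻¹ := by simp [z]
  have hz : ¬ ∃ b, z = RatFunc.C b := by
    rintro ⟨b, hb⟩
    rw [hb, ← map_sub, ← map_inv₀] at hX
    have h1 : algebraMap k[X] (RatFunc k) X = algebraMap k[X] (RatFunc k) (Polynomial.C (b - c)⁻¹) := by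
      rw [RatFunc.algebraMap_X, RatFunc.algebraMap_C, hX]
    exact Polynomial.X_ne_C _ (RatFunc.algebraMap_injective k h1)
  have htop : IntermediateField.adjoin k {z} = ⊤ := by
    rw [eq_top_iff, ← RatFunc.adjoin_X, IntermediateField.adjoin_simple_le_iff, hX]
    refine inv_mem (sub_mem (IntermediateField.mem_adjoin_simple_self k z) ?_)
    exact IntermediateField.algebraMap_mem _ c
  refine ⟨(RatFunc.algEquivOfTranscendental z (RatFunc.transcendental_of_ne_C z hz)).trans
    ((IntermediateField.equivOfEq htop).trans IntermediateField.topEquiv), ?_⟩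
  rw [← RatFunc.algebraMap_X]
  simp

theorem mem_of_isIntegral {K R : Type*} [Field K] [CommRing R] [Algebra R K]
    {V : ValuationSubring K} (hR : ∀ r, algebraMap R K r ∈ V) {z : K} (hz : IsIntegral R z) :
    z ∈ V := by
  have h1 : IsIntegral V z := by
    obtain ⟨p, hp, hz⟩ := hz
    refine ⟨p.map ((algebraMap R K).codRestrict V.toSubring hR), hp.map _, ?_⟩
    rw [eval₂_map]
    exact hz
  obtain ⟨w, rfl⟩ := IsIntegrallyClosed.isIntegral_iff.1 h1
  exact w.2

theorem mem_of_aeval_mem {k K : Type*} [Field k] [Field K] [Algebra k K] {V : ValuationSubring K}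
    (hk : ∀ c : k, algebraMap k K c ∈ V) {p : k[X]} (hp : p.natDegree ≠ 0) {z : K}
    (h : aeval z p ∈ V) : z ∈ V := by
  let : Algebra k V := ((algebraMap k K).codRestrict V.toSubring hk).toAlgebra
  have : IsScalarTower k V K := IsScalarTower.of_algebraMap_eq fun _ => rfl
  exact mem_of_isIntegral (R := V) (fun r => r.2)
    (isIntegral_of_aeval_eq_algebraMap (r := (⟨_, h⟩ : V)) hp rfl)

theorem aeval_mem {k K : Type*} [Field k] [Field K] [Algebra k K] {V : ValuationSubring K}
    (hk : ∀ c : k, algebraMap k K c ∈ V) {z : K} (hz : z ∈ V) (p : k[X]) : aeval z p ∈ V := by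
  rw [aeval_eq_sum_range]
  exact sum_mem fun i _ => by
    rw [Algebra.smul_def]
    exact mul_mem (hk _) (pow_mem hz i)

/-- The ideal of the graph `Y = h(X)`. -/
theorem ker_aeval_graph {k : Type*} [Field k] (h : k[X]) :
    RingHom.ker (MvPolynomial.aeval ![X, h] : MvPolynomial (Fin 2) k →ₐ[k] k[X]) = Ideal.span
      {MvPolynomial.X 1 - aeval (MvPolynomial.X 0 : MvPolynomial (Fin 2) k) h} := by
  set ev : MvPolynomial (Fin 2) k →ₐ[k] k[X] := MvPolynomial.aeval ![X, h]
  set J := Ideal.span {MvPolynomial.X 1 - aeval (MvPolynomial.X 0 : MvPolynomial (Fin 2) k) h}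
  set σ : k[X] →ₐ[k] MvPolynomial (Fin 2) k := aeval (MvPolynomial.X 0)
  have hev : ∀ p : k[X], ev (σ p) = p := fun p => by
    simp only [σ]
    rw [← aeval_algHom_apply]
    exact (congrArg (aeval · p) (MvPolynomial.aeval_X _ _)).trans (aeval_X_left_apply p)
  have h0 : ev (MvPolynomial.X 0) = X := MvPolynomial.aeval_X _ _
  have h1 : ev (MvPolynomial.X 1) = h := MvPolynomial.aeval_X _ _
  -- Modulo J, every polynomial equals its restriction to the graph, so the kernel is no larger than
  -- J.
  have hsec : ∀ p : MvPolynomial (Fin 2) k, p - σ (ev p) ∈ J := fun p => by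
    induction p using MvPolynomial.induction_on with
    | C a =>
      have e : σ (ev (MvPolynomial.C a)) = MvPolynomial.C a := by
        rw [← MvPolynomial.algebraMap_eq, AlgHom.commutes, AlgHom.commutes]
      rw [e, sub_self]
      exact zero_mem _
    | add p q hp hq =>
      rw [map_add, map_add, add_sub_add_comm]
      exact add_mem hp hq
    | mul_X p i hp =>
      have hi : MvPolynomial.X i - σ (ev (MvPolynomial.X i)) ∈ J := by
        revert i
        rw [Fin.forall_fin_two]
        refine ⟨?_, ?_⟩
        · rw [h0, aeval_X, sub_self]
          exact zero_mem _
        · rw [h1]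
          exact Ideal.mem_span_singleton_self _
      have e : p * MvPolynomial.X i - σ (ev (p * MvPolynomial.X i)) =
          (p - σ (ev p)) * MvPolynomial.X i +
            σ (ev p) * (MvPolynomial.X i - σ (ev (MvPolynomial.X i))) := by
        rw [map_mul, map_mul]; ring
      rw [e]
      exact add_mem (Ideal.mul_mem_right _ _ hp) (Ideal.mul_mem_left _ _ hi)
  refine le_antisymm (fun p hp => ?_) ?_
  · have := hsec p
    rwa [(RingHom.mem_ker).1 hp, map_zero, sub_zero] at this
  · rw [Ideal.span_singleton_le_iff_mem, RingHom.mem_ker, map_sub, hev, h1, sub_self]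

namespace Component

variable {k : Type*} [Field k] {f g : k[X]} (C : Component f g)

theorem algebraMap_mem_valuationSubring {V : ValuationSubring C.FunctionField}
    (hk : ∀ c : k, algebraMap k C.FunctionField c ∈ V) (hX : C.funX ∈ V) (hY : C.funY ∈ V)
    (r : C.CoordRing) : algebraMap C.CoordRing C.FunctionField r ∈ V := by
  obtain ⟨p, rfl⟩ := Ideal.Quotient.mk_surjective r
  induction p using MvPolynomial.induction_on with
  | C a => exact hk a
  | add p q hp hq => rw [map_add, map_add]; exact add_mem hp hq
  | mul_X p i hp =>
    rw [map_mul, map_mul]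
    refine mul_mem hp ?_
    fin_cases i
    · exact hX
    · exact hY

/-- The function `X` has a pole at every boundary point. -/
theorem funX_notMem_place (hg : g.natDegree ≠ 0) (P : C.GeomBoundaryPoint) : C.funX ∉ P.place := by
  intro hX
  obtain ⟨r, hr, hrP⟩ := P.atInfinity
  -- Since g(Y) = f(X), Y is regular wherever X is; then the whole normalization would be regular at
  -- P.
  have hY : C.funY ∈ P.place := mem_of_aeval_mem P.const_mem hg <| by
    rw [← aeval_funX_eq_aeval_funY]
    exact aeval_mem P.const_mem hX f
  exact hrP (mem_of_isIntegral (C.algebraMap_mem_valuationSubring P.const_mem hX hY)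
    (mem_integralClosure_iff _ _ |>.1 hr))

/-- If `C` has exactly one geometric point at infinity, the function field has a coordinate
in which `X` is a polynomial. -/
theorem exists_polynomial_coordinate [CharZero k] (hg : g.natDegree ≠ 0) (hrat : C.IsRational)
    (hcard : Nat.card C.GeomBoundaryPoint = 1) :
    ∃ φ : C.FunctionField ≃ₐ[k] RatFunc k, ∃ A : k[X], A.natDegree ≠ 0 ∧
      φ C.funX = algebraMap k[X] (RatFunc k) A := by
  obtain ⟨hsub, ⟨P₀⟩⟩ := Nat.card_eq_one_iff_unique.1 hcard
  have hdenom {φ : C.FunctionField ≃ₐ[k] RatFunc k}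
      (hφ : ∀ α : AlgebraicClosure k, aeval α (φ C.funX).denom ≠ 0) :
      ∃ A : k[X], A.natDegree ≠ 0 ∧ φ C.funX = algebraMap k[X] (RatFunc k) A := by
    have hdeg : (φ C.funX).denom.degree = 0 := by
      by_contra hne
      obtain ⟨α, hα⟩ := IsAlgClosed.exists_aeval_eq_zero (AlgebraicClosure k) _ hne
      exact hφ α hα
    have hone : (φ C.funX).denom = 1 :=
      (Polynomial.Monic.natDegree_eq_zero (RatFunc.monic_denom _)).1
        (natDegree_eq_of_degree_eq_some hdeg)
    have hnum : φ C.funX = algebraMap k[X] (RatFunc k) (φ C.funX).num := by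
      conv_lhs => rw [← RatFunc.num_div_denom (φ C.funX), hone, map_one, div_one]
    -- X is nonconstant because it has a pole at P₀, while constants are regular there.
    refine ⟨_, fun h0 => C.funX_notMem_place hg P₀ ?_, hnum⟩
    rw [eq_C_of_natDegree_eq_zero h0] at hnum
    have : C.funX = algebraMap k C.FunctionField ((φ C.funX).num.coeff 0) := by
      apply φ.injective
      rw [φ.commutes, hnum, IsScalarTower.algebraMap_apply k k[X] (RatFunc k)]
      simp
    rw [this]
    exact P₀.const_mem _
  obtain ⟨φ⟩ := hrat
  by_cases hroot : ∀ α : AlgebraicClosure k, aeval α (φ C.funX).denom ≠ 0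
  · exact ⟨φ, hdenom hroot⟩
  · push Not at hroot
    obtain ⟨α, hα⟩ := hroot
    obtain ⟨P, hP, hPα⟩ := C.exists_boundaryPoint φ hα
    -- Any two roots of the denominator come from the same boundary point, where t has one residue;
    -- so the root is unique and lies in k.
    obtain ⟨c, hc⟩ := exists_algebraMap_eq_of_unique_root hα fun β hβ => by
      obtain ⟨Q, hQ, hQβ⟩ := C.exists_boundaryPoint φ hβ
      obtain rfl : P = Q := Subsingleton.elim _ _
      exact hQβ.symm.trans hPα
    obtain ⟨e, he⟩ := exists_algEquiv_inversion c
    refine ⟨φ.trans e, hdenom fun β hβ => ?_⟩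
    -- A finite pole in the new coordinate s would be the same point P. There s is regular and t - c
    -- has residue 0, against s(t - c) = 1.
    obtain ⟨Q, hQ, -⟩ := C.exists_boundaryPoint (φ.trans e) hβ
    obtain rfl : P = Q := Subsingleton.elim _ _
    set t := φ.symm RatFunc.X
    set s := (φ.trans e).symm RatFunc.X
    have hst : s * (t - algebraMap k C.FunctionField c) = 1 := by
      apply (φ.trans e).injective
      have h1 : (φ.trans e) s = RatFunc.X := AlgEquiv.apply_symm_apply _ _
      have h2 : (φ.trans e) t = RatFunc.C c + (RatFunc.X)⁻¹ := by simp [t, he]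
      rw [map_mul, map_sub, h1, h2, AlgEquiv.commutes, map_one, RatFunc.algebraMap_eq_C,
        add_sub_cancel_left, mul_inv_cancel₀ RatFunc.X_ne_zero]
    have hst' : (⟨s, hQ⟩ : P.place) * (⟨t, hP⟩ - ⟨_, P.const_mem c⟩) = 1 := Subtype.ext hst
    have h1 := congrArg (fun z => P.emb (IsLocalRing.residue P.place z)) hst'
    have h2 : P.emb (IsLocalRing.residue P.place ⟨t, hP⟩) = α := hPα
    simp only [map_mul, map_sub, map_one, P.emb_const, hc] at h1
    rw [h2, sub_self, mul_zero] at h1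
    exact zero_ne_one h1

/-- φ carries k(X) onto k(A), and k(t) has degree max(deg A, 0) over k(A). -/
theorem degX_eq_natDegree (φ : C.FunctionField ≃ₐ[k] RatFunc k) {A : k[X]}
    (hA : φ C.funX = algebraMap k[X] (RatFunc k) A) : C.degX = A.natDegree := by
  have h1 := RatFunc.finrank_eq_max_natDegree (algebraMap k[X] (RatFunc k) A)
  rw [RatFunc.num_algebraMap, RatFunc.denom_algebraMap, natDegree_one, Nat.max_zero] at h1
  rw [← h1, degX]
  have hmap : (IntermediateField.adjoin k {C.funX}).map (φ : C.FunctionField →ₐ[k] RatFunc k) =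
      IntermediateField.adjoin k {algebraMap k[X] (RatFunc k) A} := by
    rw [IntermediateField.adjoin_map, Set.image_singleton, ← hA]; rfl
  refine Algebra.finrank_eq_of_equiv_equiv
    (((IntermediateField.adjoin k {C.funX}).intermediateFieldMap φ).trans
      (IntermediateField.equivOfEq hmap)).toRingEquiv φ.toRingEquiv ?_
  ext z
  rfl

/-- A component on which `Y = h(X)` identically is the graph of `h`. -/
theorem isGraph_of_funY_eq {h : k[X]} (hfg : f = g.comp h) (hY : C.funY = aeval C.funX h) :
    C.IsGraph := by
  refine ⟨h, hfg, ?_⟩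
  have hker := ker_aeval_graph h
  set ev : MvPolynomial (Fin 2) k →ₐ[k] k[X] := MvPolynomial.aeval ![X, h]
  have hprime : (RingHom.ker ev).IsPrime := RingHom.ker_isPrime _
  rw [hker] at hprime
  have hmem : MvPolynomial.X 1 - aeval (MvPolynomial.X 0 : MvPolynomial (Fin 2) k) h ∈ C.ideal := by
    rw [← Ideal.Quotient.eq_zero_iff_mem]
    apply FaithfulSMul.algebraMap_injective C.CoordRing C.FunctionField
    rw [map_zero, map_sub, map_sub, sub_eq_zero]
    refine Eq.trans hY ?_
    rw [funX, aeval_algebraMap_apply]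
    congr 1
    exact aeval_algHom_apply (Ideal.Quotient.mkₐ k C.ideal) (MvPolynomial.X 0) h
  -- The graph ideal is prime, contains f(X) - g(Y) and lies in the ideal of C; minimality of the
  -- latter forces equality.
  refine le_antisymm (C.mem_minimalPrimes.2 ⟨hprime, ?_⟩ ?_) ?_
  · rw [Ideal.span_singleton_le_iff_mem, ← hker, RingHom.mem_ker, curvePoly, map_sub,
      ← aeval_algHom_apply, ← aeval_algHom_apply]
    simp [ev, hfg, comp_eq_aeval]
  · exact (Ideal.span_singleton_le_iff_mem _).2 hmem
  · exact (Ideal.span_singleton_le_iff_mem _).2 hmem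

/-- A polynomial parametrization of a component with one geometric point at infinity. -/
theorem exists_polynomial_parametrization {k : Type*} [Field k] [NumberField k] {f g : k[X]}
    (C : Component f g) (S : Finset (NFPlace k)) (hg : g.natDegree ≠ 0) (hC : C.IsOneInfinity)
    (hact : C.IsSActive S) :
    ∃ A D : k[X], ∃ τ₀ : k, A.natDegree ≠ 0 ∧ C.degX = A.natDegree ∧ f.comp A = g.comp D ∧
      (∀ h : k[X], f = g.comp h → D ≠ h.comp A) ∧ A.eval τ₀ ∈ sIntegers S := by
  obtain ⟨φ, A, hA0, hA⟩ := C.exists_polynomial_coordinate hg hC.isRational hC.card_boundary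
  have hfg : aeval (φ C.funX) f = aeval (φ C.funY) g := by
    rw [aeval_algHom_apply φ, aeval_algHom_apply φ, aeval_funX_eq_aeval_funY]
  have hcomp (p q : k[X]) : aeval (algebraMap k[X] (RatFunc k) q) p =
      algebraMap k[X] (RatFunc k) (p.comp q) := by
    rw [aeval_algebraMap_apply, comp_eq_aeval]
  have hint : IsIntegral k[X] (φ C.funY) :=
    isIntegral_of_aeval_eq_algebraMap hg (hfg.symm.trans (hA ▸ hcomp f A))
  obtain ⟨D, hD⟩ := IsIntegrallyClosed.isIntegral_iff.1 hint
  obtain ⟨p, hp⟩ := hact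
  set t := φ.symm RatFunc.X
  have ht : aeval t A = C.funX := by
    apply φ.injective
    rw [← aeval_algHom_apply φ, hA]
    simp [t, ← RatFunc.algebraMap_X, aeval_algebraMap_apply]
  -- t satisfies A(t) = X, hence is regular on the normalization, and its value at the active point
  -- is τ₀.
  have htint : t ∈ C.Normalization :=
    (mem_integralClosure_iff _ _).2 (isIntegral_of_aeval_eq_algebraMap hA0 ht)
  refine ⟨A, D, p ⟨t, htint⟩, hA0, C.degX_eq_natDegree φ hA, ?_, fun h hh hDh => ?_, ?_⟩
  · apply RatFunc.algebraMap_injective k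
    rw [← hcomp, ← hcomp, ← hA, hD, hfg]
  · refine hC.not_isGraph (C.isGraph_of_funY_eq hh (φ.injective ?_))
    rw [← aeval_algHom_apply φ, hA, hcomp, ← hDh, hD]
  · rw [← coe_aeval_eq_eval, aeval_algHom_apply]
    convert hp
    apply Subtype.ext
    refine Eq.trans ?_ ht
    exact (aeval_algHom_apply (C.Normalization.val.restrictScalars k) ⟨t, htint⟩ A).symm

end Component

end SparseLifting

end

namespace SparseLifting

theorem newCount_mono {k : Type*} [Field k] [NumberField k] (f g : k[X])
    (S : Finset (NFPlace k)) : Monotone fun B : ℝ => (newCount f g S B : ℝ) := by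
  intro B B' h
  exact Nat.cast_le.2 <| Set.ncard_le_ncard (fun a ha => ⟨ha.1, ha.2.1.trans h, ha.2.2⟩)
    (finite_newInputs f g S B')

end SparseLifting

open SparseLifting in
theorem theorem5p2 {k : Type*} [Field k] [NumberField k]
    (S : Finset (NFPlace k)) (hS : ∀ v : InfinitePlace k, Sum.inl v ∈ S)
    (f g : k[X]) (hf : f.natDegree ≠ 0) (hg : g.natDegree ≠ 0)
    (C : Component f g) (hC : C.IsOneInfinity) (hact : C.IsSActive S) :
    (∃ c : ℝ, 0 < c ∧ ∃ B₀ : ℝ, ∀ B : ℝ, B₀ ≤ B →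
      c * (B ^ ((Module.finrank ℚ k : ℝ) / (C.degX : ℝ)) * Real.log (2 * B) ^ (S.card - 1))
        ≤ (newCount f g S B : ℝ)) ∧
    (∀ α β : ℝ,
      ((fun B : ℝ => (newCount f g S B : ℝ)) =O[atTop]
        fun B : ℝ => B ^ α * Real.log (2 * B) ^ β) →
      (Module.finrank ℚ k : ℝ) / (C.degX : ℝ) < α ∨
        ((Module.finrank ℚ k : ℝ) / (C.degX : ℝ) = α ∧ ((S.card - 1 : ℕ) : ℝ) ≤ β)) := by
  obtain ⟨A, D, τ₀, hA, hdeg, hfg, hD, hτ₀⟩ := C.exists_polynomial_parametrization S hg hC hact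
  obtain ⟨c, hc, K, hK, M₀, hM⟩ := exists_many_newInputs S hS hg hA hfg hD hτ₀
  obtain ⟨c', hc', B₀, hB⟩ := lower_bound_of_subsequence (newCount_mono f g S) hc hK hA _ _ M₀ hM
  rw [← hdeg] at hB
  exact ⟨⟨c', hc', B₀, hB⟩, fun α β hO => exponents_le_of_isBigO hc' _ hB hO⟩
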